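/- Let $r,s\ge 0$ be integers and let $\boldsymbol{\alpha}=(\alpha_1,\dots,\alpha_r)$ and $\boldsymbol{\beta}=(\beta_1,\dots,\beta_s)$ be tuples of elements of $\mathbb{Q}\setminus\mathbb{Z}_{\le 0}$. Put $$F_{\boldsymbol{\alpha},\boldsymbol{\beta}}(z)=\sum_{n=0}^\infty\frac{(\alpha_1)_n\cdots(\alpha_r)_n}{(\beta_1)_n\cdots(\beta_s)_n}z^n,\qquad (x)_n=x(x+1)\cdots(x+n-1),\ (x)_0=1.$$ Assume that $F_{\boldsymbol{\alpha},\boldsymbol{\beta}}$ is $N$-integral, i.e. that there is a nonzero $c\in\mathbb{Q}$ with $F_{\boldsymbol{\alpha},\boldsymbol{\beta}}(cz)\in\mathbb{Z}[[z]]$. Then there is a unique positive rational number $C_{\boldsymbol{\alpha},\boldsymbol{\beta}}$ (the Eisenstein constant of $F_{\boldsymbol{\alpha},\boldsymbol{\beta}}$) such that $$\{x\in\mathbb{Q} : F_{\boldsymbol{\alpha},\boldsymbol{\beta}}(xz)\in\mathbb{Z}[[z]]\}=C_{\boldsymbol{\alpha},\boldsymbol{\beta}}\mathbb{Z}.$$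 For $a\in\mathbb{Q}$ let $d(a)\ge 1$ be the exact denominator of $a$, let $d_{\boldsymbol{\alpha},\boldsymbol{\beta}}$ be the least common multiple of all the $d(\alpha_i)$ and $d(\beta_j)$, for a prime $p$ let $$\lambda_p=\#\{1\le i\le r : \alpha_i\in\mathbb{Z}_p\}-\#\{1\le j\le s : \beta_j\in\mathbb{Z}_p\},$$ and let $\mathcal{P}$ be the (finite) set of all primes $p$ such that $p\mid d_{\boldsymbol{\alpha},\boldsymbol{\beta}}$ or $p\le r-s+1$. Then there is a positive integer $C$ such that $$C_{\boldsymbol{\alpha},\boldsymbol{\beta}}=C\,\frac{\prod_{i=1}^r d(\alpha_i)}{\prod_{j=1}^s d(\beta_j)}\prod_{p\in\mathcal{P}}p^{-\left\lfloor\frac{\lambda_p}{p-1}\right\rfloor}.$$ Furthermore, if $r=s$ and all the $\alpha_i$ and $\beta_j$ lie in $(0,1]$, then $C=1$. -/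

import Mathlib

/-- A power series `f` over `ℚ` lies in `ℤ[[z]]`. -/
def HasIntegerCoeffs (f : PowerSeries ℚ) : Prop :=
  ∃ g : PowerSeries ℤ, PowerSeries.map (Int.castRingHom ℚ) g = f

/-- `f` is `N`-integral: `f(cz) ∈ ℤ[[z]]` for some nonzero rational `c`.
(For `c = 0` the condition would only concern the constant term.) -/
def IsNIntegral (f : PowerSeries ℚ) : Prop :=
  ∃ c : ℚ, c ≠ 0 ∧ HasIntegerCoeffs (PowerSeries.rescale c f)

/-- `c` is the Eisenstein constant of `f`: the positive rational number such that the set of all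
`x ∈ ℚ` with `f(xz) ∈ ℤ[[z]]` is `cℤ`. -/
def IsEisensteinConstant (f : PowerSeries ℚ) (c : ℚ) : Prop :=
  0 < c ∧ {x : ℚ | HasIntegerCoeffs (PowerSeries.rescale x f)} = {x : ℚ | ∃ k : ℤ, x = c * k}

/-- The generalized hypergeometric series
`F_{α,β}(z) = ∑ₙ (α₁)ₙ⋯(α_r)ₙ / ((β₁)ₙ⋯(β_s)ₙ) zⁿ`. -/
noncomputable def hypergeometricSeries {r s : ℕ} (α : Fin r → ℚ) (β : Fin s → ℚ) :
    PowerSeries ℚ :=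
  PowerSeries.mk fun n =>
    (∏ i, (ascPochhammer ℚ n).eval (α i)) / (∏ j, (ascPochhammer ℚ n).eval (β j))

/-- The least common multiple `d_{α,β}` of the exact denominators of the parameters. -/
def commonDenominator {r s : ℕ} (α : Fin r → ℚ) (β : Fin s → ℚ) : ℕ :=
  Nat.lcm (Finset.univ.lcm fun i => (α i).den) (Finset.univ.lcm fun j => (β j).den)

theorem commonDenominator_pos {r s : ℕ} (α : Fin r → ℚ) (β : Fin s → ℚ) :
    0 < commonDenominator α β := by
  refine Nat.lcm_pos (Nat.pos_of_ne_zero ?_) (Nat.pos_of_ne_zero ?_) <;>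
  · rw [Ne, Finset.lcm_eq_zero_iff]
    simp

/-- `λ_p(α,β) = #{i : α_i ∈ ℤ_p} - #{j : β_j ∈ ℤ_p}`, where a rational number lies in `ℤ_p` when
its `p`-adic norm is at most `1`. -/
def lambdaP (p : ℕ) {r s : ℕ} (α : Fin r → ℚ) (β : Fin s → ℚ) : ℤ :=
  ((Finset.univ.filter fun i => padicNorm p (α i) ≤ 1).card : ℤ) -
    ((Finset.univ.filter fun j => padicNorm p (β j) ≤ 1).card : ℤ)

/-- The finite set `𝒫_{α,β}` of all primes `p` with `p ∣ d_{α,β}` or `p ≤ r - s + 1`; the bound in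
`Finset.range` is no restriction, see `mem_exceptionalPrimes`. -/
def exceptionalPrimes {r s : ℕ} (α : Fin r → ℚ) (β : Fin s → ℚ) : Finset ℕ :=
  (Finset.range (commonDenominator α β + r + 2)).filter fun p =>
    p.Prime ∧ (p ∣ commonDenominator α β ∨ (p : ℤ) ≤ (r : ℤ) - (s : ℤ) + 1)

theorem mem_exceptionalPrimes {r s : ℕ} (α : Fin r → ℚ) (β : Fin s → ℚ) (p : ℕ) :
    p ∈ exceptionalPrimes α β ↔
      p.Prime ∧ (p ∣ commonDenominator α β ∨ (p : ℤ) ≤ (r : ℤ) - (s : ℤ) + 1) := by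
  unfold exceptionalPrimes
  rw [Finset.mem_filter, Finset.mem_range]
  refine ⟨fun h => h.2, fun h => ⟨?_, h⟩⟩
  rcases h.2 with h | h
  · have := Nat.le_of_dvd (commonDenominator_pos α β) h
    omega
  · omega

/-! Integrality is tested prime by prime: a nonzero x rescales F into ℤ[[z]] iff Q_p(n) + n(v_p(x) -
δ_p) ≥ 0 for all p and n, where Q_p is `quotVal` and δ_p is `denVal`. The admissible x form a cyclic
group, because they are closed under addition and lie in a⁻¹ℤ, with a ≠ 0 the coefficient of z; this
gives the constant c. It is compared with the predicted value E, `eisensteinDivisor`.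

c/E is an integer: at n = p^m one has (p-1)Q_p(n) = λ_p n + O(1), so v_p(c) - δ_p ≥ -λ_p/(p-1)
(`neg_lambdaP_le`). Rounding to integers gives the exponents in E; outside 𝒫 one has λ_p < p-1, and
the rounded bound is still at least 0.

For r = s and parameters in (0,1], E itself is admissible by the uniform bound (p-1)Q_p(n) ≥ λ_p n
(`lambdaP_mul_le_quotVal`). Integrality at large primes in a chosen residue class yields Christol's
inequalities between Landau counts, one for each multiplier prime to the denominators
(`sum_landau_le_sum_landau`). For fixed p they are averaged, at each level l, over the multipliers
congruent to p^(-l) modulo the prime-to-p part of the denominators. Up to a factor p^g, a parameter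
in ℤ_p contributes p-1 times its Legendre sum, and any other parameter contributes exactly n, by
Hermite's identity and telescoping (`sum_landau_average`). -/

/-! ### Landau counting functions and Hermite's identity -/

/-- The number of `w ∈ b + ℤ` with `0 < w ≤ T`, written as a difference of floors. -/
def landau (b T : ℚ) : ℤ := ⌊T - b⌋ - ⌊-b⌋

theorem landau_add_intCast (b T : ℚ) (k : ℤ) : landau (b + k) T = landau b T := by
  have h1 : T - (b + k) = T - b - (k : ℤ) := by ring
  have h2 : -(b + (k : ℚ)) = -b - (k : ℤ) := by ring
  rw [landau, landau, h1, h2, Int.floor_sub_intCast, Int.floor_sub_intCast]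
  ring

theorem landau_congr_left {b b' : ℚ} (T : ℚ) (k : ℤ) (h : b - b' = k) :
    landau b T = landau b' T := by
  rw [← landau_add_intCast b' T k, ← h, add_sub_cancel]

theorem landau_add_intCast_right (b T : ℚ) (k : ℤ) : landau b (T + k) = landau b T + k := by
  have h1 : T + k - b = T - b + (k : ℤ) := by ring
  rw [landau, landau, h1, Int.floor_add_intCast]
  ring

theorem landau_zero (b : ℚ) : landau b 0 = 0 := by simp [landau]

theorem landau_intCast (b : ℚ) (k : ℤ) : landau b k = k := by
  have := landau_add_intCast_right b 0 k
  rwa [landau_zero, zero_add, zero_add] at this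

/-- As Db is an integer, the count jumps only at points of D⁻¹ℤ, so T matters only through ⌊DT⌋. -/
theorem landau_congr_right {b T T' : ℚ} {D : ℕ} (hD : 0 < D) (k : ℤ) (hb : (D : ℚ) * b = k)
    (h : ⌊(D : ℚ) * T⌋ = ⌊(D : ℚ) * T'⌋) : landau b T = landau b T' := by
  have key : ∀ U : ℚ, ⌊U - b⌋ = (⌊(D : ℚ) * U⌋ - k) / (D : ℤ) := fun U => by
    rw [← Int.floor_sub_intCast, ← Int.floor_div_natCast, ← hb]
    congr 1
    field_simp
  rw [landau, landau, key, key, h]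

/-- Hermite's identity. -/
theorem sum_floor_add_div (y : ℚ) {m : ℕ} (hm : 0 < m) :
    ∑ i ∈ Finset.range m, ⌊y + i / m⌋ = ⌊(m : ℚ) * y⌋ := by
  have key : ∀ i : ℕ, ⌊y + i / m⌋ = (⌊(m : ℚ) * y⌋ + i) / (m : ℤ) := fun i => by
    rw [← Int.floor_add_natCast, ← Int.floor_div_natCast]
    congr 1
    field_simp
  simp only [key]
  generalize ⌊(m : ℚ) * y⌋ = N
  -- Raising N by 1 shifts the window of m consecutive integers, replacing N by N + m and so adding
  -- 1 to the sum of quotients.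
  have step : ∀ N : ℤ, ∑ i ∈ Finset.range m, (N + 1 + i) / (m : ℤ)
      = ∑ i ∈ Finset.range m, (N + i) / (m : ℤ) + 1 := fun N => by
    have h1 := Finset.sum_range_succ (fun i : ℕ => (N + i) / (m : ℤ)) m
    have h2 := Finset.sum_range_succ' (fun i : ℕ => (N + i) / (m : ℤ)) m
    have h3 : (N + m) / (m : ℤ) = N / m + 1 := by
      rw [Int.add_ediv_of_dvd_right (dvd_refl _), Int.ediv_self (by positivity)]
    have h4 : ∑ i ∈ Finset.range m, (N + 1 + i) / (m : ℤ)
        = ∑ i ∈ Finset.range m, (N + (i + 1 : ℕ)) / (m : ℤ) :=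
      Finset.sum_congr rfl fun i _ => by push_cast; ring_nf
    simp only [Nat.cast_zero, add_zero] at h2
    linarith
  have zero : ∑ i ∈ Finset.range m, ((0 : ℤ) + i) / (m : ℤ) = 0 :=
    Finset.sum_eq_zero fun i hi => by
      rw [zero_add]
      exact Int.ediv_eq_zero_of_lt (by positivity) (by exact_mod_cast Finset.mem_range.1 hi)
  induction N using Int.induction_on with
  | zero => exact zero
  | succ n ih => rw [step, ih]
  | pred n ih =>
    have := step (-n - 1)
    rw [sub_add_cancel, ih] at this
    linarith

theorem sum_landau_sub_div (y T : ℚ) {m : ℕ} (hm : 0 < m) :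
    ∑ i ∈ Finset.range m, landau (y - i / m) T = landau (m * y) (m * T) := by
  have h1 : ∀ i : ℕ, T - (y - i / m) = (T - y) + i / m := fun i => by ring
  have h2 : ∀ i : ℕ, -(y - i / m) = -y + i / (m : ℚ) := fun i => by ring
  simp only [landau, h1, h2, Finset.sum_sub_distrib, sum_floor_add_div _ hm]
  congr 2 <;> ring

theorem sum_range_mul_of_periodic {F : ℤ → ℤ} {m : ℕ} (hF : ∀ i k : ℤ, F (i + m * k) = F i)
    (hm : 0 < m) {u : ℤ} (hu : IsCoprime u m) (k : ℕ) :
    ∑ i ∈ Finset.range (m * k), F (u * i) = k * ∑ i ∈ Finset.range m, F i := by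
  have : NeZero m := ⟨hm.ne'⟩
  have hcongr : ∀ i j : ℤ, (i : ZMod m) = j → F i = F j := fun i j h => by
    obtain ⟨c, hc⟩ := (ZMod.intCast_eq_intCast_iff_dvd_sub j i m).1 h.symm
    rw [← hF j c, ← hc, add_sub_cancel]
  have hperm : ∑ i ∈ Finset.range m, F (u * i) = ∑ i ∈ Finset.range m, F i := by
    have huu : IsUnit (u : ZMod m) := by
      rwa [ZMod.coe_int_isUnit_iff_isCoprime, isCoprime_comm]
    have conv : ∀ G : ℤ → ℤ, (∀ i j : ℤ, (i : ZMod m) = j → G i = G j) →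
        ∑ i ∈ Finset.range m, G i = ∑ z : ZMod m, G z.val := fun G hG => by
      refine Finset.sum_bij' (fun i _ => (i : ZMod m)) (fun z _ => z.val) (by simp)
        (fun z _ => Finset.mem_range.2 (ZMod.val_lt z))
        (fun i hi => ZMod.val_cast_of_lt (Finset.mem_range.1 hi)) (by simp) (fun i _ => ?_)
      exact hG _ _ (by simp)
    rw [conv F hcongr, conv (fun i => F (u * i)) fun i j h => hcongr _ _ (by push_cast; rw [h])]
    refine Fintype.sum_equiv (Units.mulLeft huu.unit) _ _ fun z => hcongr _ _ ?_
    simp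
  induction k with
  | zero => simp
  | succ k ih =>
    rw [Nat.mul_succ, Finset.sum_range_add, ih]
    have : ∑ x ∈ Finset.range m, F (u * ((m * k + x : ℕ) : ℤ)) = ∑ i ∈ Finset.range m, F i := by
      rw [← hperm]
      refine Finset.sum_congr rfl fun x _ => ?_
      rw [← hF (u * x) (u * k)]
      push_cast
      ring_nf
    rw [this]
    push_cast
    ring

/-- Modulo ℤ the shifts iu/m run k times through all multiples of 1/m, since u is invertible modulo
m; Hermite's identity handles each round. -/
theorem sum_landau_add_mul_div (y T : ℚ) {m : ℕ} (hm : 0 < m) {u : ℤ} (hu : IsCoprime u m)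
    (k : ℕ) :
    ∑ i ∈ Finset.range (m * k), landau (y + i * (u / m)) T = k * landau (m * y) (m * T) := by
  have hm' : (m : ℚ) ≠ 0 := by positivity
  have h := sum_range_mul_of_periodic (F := fun i => landau (y - i / m) T) (m := m)
    (fun i c => landau_congr_left T (-c) (by push_cast; field_simp; ring)) hm
    (IsCoprime.neg_left hu) k
  simp only [Int.cast_natCast, sum_landau_sub_div y T hm] at h
  rw [← h]
  refine Finset.sum_congr rfl fun i _ => ?_
  congr 1
  push_cast
  ring

theorem sum_filter_not_dvd (F : ℕ → ℤ) {p : ℕ} (hp : 0 < p) (m : ℕ) :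
    ∑ i ∈ (Finset.range (p * m)).filter (fun i => ¬ p ∣ i), F i
      = ∑ i ∈ Finset.range (p * m), F i - ∑ j ∈ Finset.range m, F (p * j) := by
  have h : ∑ i ∈ (Finset.range (p * m)).filter (fun i => p ∣ i), F i
      = ∑ j ∈ Finset.range m, F (p * j) := by
    refine Finset.sum_bij' (fun i _ => i / p) (fun j _ => p * j) ?_ ?_ ?_ ?_ ?_
    · intro i hi
      simp only [Finset.mem_filter, Finset.mem_range] at hi ⊢
      exact Nat.div_lt_of_lt_mul hi.1
    · intro j hj
      simp only [Finset.mem_filter, Finset.mem_range] at hj ⊢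
      exact ⟨Nat.mul_lt_mul_of_pos_left hj hp, Dvd.intro _ rfl⟩
    · intro i hi
      exact Nat.mul_div_cancel' (Finset.mem_filter.1 hi).2
    · intro j _
      exact Nat.mul_div_cancel_left j hp
    · intro i hi
      rw [Nat.mul_div_cancel' (Finset.mem_filter.1 hi).2]
  rw [← h, ← Finset.sum_filter_add_sum_filter_not (Finset.range (p * m)) (fun i => p ∣ i)]
  ring

/-! ### Valuations of Pochhammer products as sums of Landau counts -/

/-- The `p`-adic valuation of `∏_{k < n} (num x + k den x)`. -/
def shiftedVal (p : ℕ) (x : ℚ) (n : ℕ) : ℤ :=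
  ∑ k ∈ Finset.range n, (padicValInt p (x.num + k * x.den) : ℤ)

theorem add_natCast_eq_div (x : ℚ) (k : ℕ) :
    x + k = ((x.num + k * x.den : ℤ) : ℚ) / ((x.den : ℕ) : ℚ) := by
  have hd : (x.den : ℚ) ≠ 0 := by exact_mod_cast x.den_nz
  rw [eq_div_iff hd]
  push_cast
  rw [add_mul, Rat.mul_den_eq_num]

theorem num_add_mul_den_ne_zero {x : ℚ} (hx : ∀ k : ℕ, x ≠ -(k : ℚ)) (k : ℕ) :
    x.num + k * x.den ≠ 0 := fun h => by
  have := add_natCast_eq_div x k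
  rw [h, Int.cast_zero, zero_div] at this
  exact hx k (eq_neg_of_add_eq_zero_left this)

theorem ascPochhammer_eval_ne_zero {x : ℚ} (hx : ∀ k : ℕ, x ≠ -(k : ℚ)) (n : ℕ) :
    (ascPochhammer ℚ n).eval x ≠ 0 := by
  induction n with
  | zero => simp
  | succ n ih =>
    rw [ascPochhammer_succ_eval]
    exact mul_ne_zero ih fun h => hx n (eq_neg_of_add_eq_zero_left h)

theorem padicValRat_ascPochhammer {p : ℕ} [Fact p.Prime] {x : ℚ} (hx : ∀ k : ℕ, x ≠ -(k : ℚ))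
    (n : ℕ) : padicValRat p ((ascPochhammer ℚ n).eval x)
      = shiftedVal p x n - n * padicValNat p x.den := by
  induction n with
  | zero => simp [shiftedVal]
  | succ n ih =>
    have h0 : x + n ≠ 0 := fun h => hx n (eq_neg_of_add_eq_zero_left h)
    have hn : ((x.num + n * x.den : ℤ) : ℚ) ≠ 0 :=
      Int.cast_ne_zero.2 (num_add_mul_den_ne_zero hx n)
    have hd : (x.den : ℚ) ≠ 0 := by exact_mod_cast x.den_nz
    have hadd : padicValRat p (x + n)
        = padicValInt p (x.num + n * x.den) - padicValNat p x.den := by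
      rw [add_natCast_eq_div, padicValRat.div hn hd, padicValRat.of_int, padicValRat.of_nat]
    rw [ascPochhammer_succ_eval, padicValRat.mul (ascPochhammer_eval_ne_zero hx n) h0, ih,
      hadd, shiftedVal, shiftedVal, Finset.sum_range_succ]
    push_cast
    ring

theorem not_dvd_num_of_dvd_den {p : ℕ} (hp : p.Prime) {x : ℚ} (h : p ∣ x.den) :
    ¬ (p : ℤ) ∣ x.num := fun hn =>
  hp.one_lt.ne' <| Nat.dvd_one.1 <| by
    have := x.reduced
    rw [← this]
    exact Nat.dvd_gcd (Int.natCast_dvd.1 hn) h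

theorem shiftedVal_eq_zero {p : ℕ} (hp : p.Prime) {x : ℚ} (h : p ∣ x.den) (n : ℕ) :
    shiftedVal p x n = 0 :=
  Finset.sum_eq_zero fun k _ => by
    rw [padicValInt.eq_zero_of_not_dvd, Nat.cast_zero]
    intro hk
    refine not_dvd_num_of_dvd_den hp h ?_
    have h2 : (p : ℤ) ∣ k * x.den := Dvd.dvd.mul_left (Int.natCast_dvd_natCast.2 h) _
    exact (dvd_add_left h2).1 hk

theorem padicValInt_eq_card {p : ℕ} [hp : Fact p.Prime] {z : ℤ} (hz : z ≠ 0) {L : ℕ}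
    (h : z.natAbs < p ^ (L + 1)) :
    padicValInt p z = ((Finset.Icc 1 L).filter fun l => ((p ^ l : ℕ) : ℤ) ∣ z).card := by
  rw [padicValInt, ← Nat.factorization_def _ hp.out,
    Nat.factorization_eq_card_pow_dvd_of_lt hp.out (Int.natAbs_pos.2 hz) h]
  congr 1
  ext l
  simp only [Finset.mem_filter, Finset.mem_Ico, Finset.mem_Icc, Int.natCast_dvd,
    Order.lt_add_one_iff]

theorem shiftedVal_eq_sum_card {p : ℕ} [Fact p.Prime] {x : ℚ} (hx : ∀ k : ℕ, x ≠ -(k : ℚ))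
    {n L : ℕ} (h : ∀ k < n, (x.num + k * x.den).natAbs < p ^ (L + 1)) :
    shiftedVal p x n = ∑ l ∈ Finset.Icc 1 L,
      (((Finset.range n).filter fun k : ℕ =>
        ((p ^ l : ℕ) : ℤ) ∣ x.num + k * x.den).card : ℤ) := by
  have h1 : shiftedVal p x n = ∑ k ∈ Finset.range n, ∑ l ∈ Finset.Icc 1 L,
      if ((p ^ l : ℕ) : ℤ) ∣ x.num + k * x.den then (1 : ℤ) else 0 :=
    Finset.sum_congr rfl fun k hk => by
      rw [padicValInt_eq_card (num_add_mul_den_ne_zero hx k) (h k (Finset.mem_range.1 hk)),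
        Finset.card_filter]
      push_cast
      rfl
  rw [h1, Finset.sum_comm]
  refine Finset.sum_congr rfl fun l _ => ?_
  rw [Finset.card_filter]
  push_cast
  rfl

theorem card_filter_dvd_add_mul {M : ℕ} (hM : 0 < M) {y d v : ℤ} (hd : IsCoprime (M : ℤ) d)
    (hv : (M : ℤ) ∣ y + v * d) (n : ℕ) :
    (((Finset.range n).filter fun k : ℕ => (M : ℤ) ∣ y + k * d).card : ℤ)
      = (n - 1 - v) / (M : ℤ) - (-1 - v) / (M : ℤ) := by
  have hcard := Int.Ioc_filter_modEq_card (-1) (n - 1) (r := M) (by exact_mod_cast hM) v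
  have hmap : ((Finset.range n).filter fun k : ℕ => (M : ℤ) ∣ y + k * d).card
      = ((Finset.Ioc (-1 : ℤ) (n - 1)).filter fun k => k ≡ v [ZMOD M]).card := by
    refine Finset.card_bij (fun k _ => (k : ℤ)) ?_ (by simp) ?_
    · intro k hk
      simp only [Finset.mem_filter, Finset.mem_range, Finset.mem_Ioc] at hk ⊢
      refine ⟨⟨by omega, by omega⟩, ?_⟩
      refine (Int.modEq_iff_dvd.2 ?_).symm
      refine hd.dvd_of_dvd_mul_right ?_
      have := dvd_sub hk.2 hv
      rwa [show y + (k : ℤ) * d - (y + v * d) = (k - v) * d by ring] at this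
    · intro k hk
      simp only [Finset.mem_filter, Finset.mem_Ioc] at hk
      obtain ⟨⟨h1, h2⟩, h3⟩ := hk
      lift k to ℕ using by omega
      refine ⟨k, ?_, rfl⟩
      simp only [Finset.mem_filter, Finset.mem_range]
      refine ⟨by omega, ?_⟩
      have h4 := Int.modEq_iff_dvd.1 h3.symm
      have := dvd_add hv (Dvd.dvd.mul_right h4 d)
      rwa [show y + v * d + ((k : ℤ) - v) * d = y + k * d by ring] at this
  have fl : ∀ a : ℤ, ⌊((a : ℚ) - v) / ((M : ℤ) : ℚ)⌋ = (a - v) / (M : ℤ) := fun a => by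
    rw [Int.cast_natCast, Int.floor_div_natCast, ← Int.cast_sub, Int.floor_intCast]
  rw [hmap, hcard]
  have f1 := fl (n - 1)
  have f2 := fl (-1)
  push_cast at f1 f2 ⊢
  rw [f1, f2, max_eq_left]
  rw [sub_nonneg]
  exact Int.ediv_le_ediv (by exact_mod_cast hM) (by omega)

/-- The divisibility says that w = (k + x)/M lies in ax + ℤ, and 0 ≤ k < n is equivalent to 0 < w ≤
n/M because 0 < x ≤ 1. -/
theorem card_filter_dvd_eq_landau {x : ℚ} (hx : x ∈ Set.Ioc (0 : ℚ) 1) {M : ℕ} (hM : 0 < M)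
    {a : ℤ} (ha : (x.den : ℤ) ∣ a * M - 1) (n : ℕ) :
    (((Finset.range n).filter fun k : ℕ => (M : ℤ) ∣ x.num + k * x.den).card : ℤ)
      = landau (a * x) (n / M) := by
  obtain ⟨c, hc⟩ := ha
  have hdx : (x.den : ℚ) * x = x.num := by rw [mul_comm, Rat.mul_den_eq_num]
  have hcop : IsCoprime (M : ℤ) x.den := ⟨a, -c, by linear_combination hc⟩
  have hv : ((c * x.num : ℤ) : ℚ) = a * M * x - x := by
    have : (a : ℚ) * M - 1 = x.den * c := by exact_mod_cast hc
    push_cast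
    linear_combination (-x) * this + (-c : ℚ) * hdx
  have hdvd : (M : ℤ) ∣ x.num + c * x.num * x.den := ⟨a * x.num, by linear_combination -x.num * hc⟩
  have hM' : (M : ℚ) ≠ 0 := by positivity
  have key : ∀ m : ℤ, ⌊(m : ℚ) / M - a * x⌋ = (m - 1 - c * x.num) / (M : ℤ) := fun m => by
    have : (m : ℚ) / M - a * x = (m - (c * x.num : ℤ) - x) / M := by
      rw [hv]
      field_simp
      ring
    -- An integer minus x has floor one less than that integer, as 0 < x ≤ 1.
    rw [this, Int.floor_div_natCast]
    congr 1
    rw [Int.floor_eq_iff]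
    push_cast
    constructor <;> linarith [hx.1, hx.2]
  rw [card_filter_dvd_add_mul hM hcop hdvd, landau]
  have k1 := key n
  have k2 := key 0
  simp only [Int.cast_natCast, Int.cast_zero, zero_div, zero_sub] at k1 k2
  rw [k1, k2]

theorem ne_neg_natCast_of_mem_Ioc {x : ℚ} (hx : x ∈ Set.Ioc (0 : ℚ) 1) (k : ℕ) :
    x ≠ -(k : ℚ) := by
  have : (0 : ℚ) ≤ k := k.cast_nonneg
  exact fun h => by linarith [hx.1]

theorem natAbs_num_add_mul_den_le {x : ℚ} (hx : x ∈ Set.Ioc (0 : ℚ) 1) {k n : ℕ} (h : k < n) :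
    (x.num + k * x.den).natAbs ≤ n * x.den := by
  have h0 : 0 < x.num := Rat.num_pos.2 hx.1
  have h1 : x.num ≤ x.den := Rat.num_le_denom_iff.2 hx.2
  have h2 : (k + 1) * x.den ≤ n * x.den := Nat.mul_le_mul_right _ h
  zify at h2 ⊢
  rw [abs_of_nonneg (by positivity)]
  linarith

/-- Legendre's formula: a^l inverts p^l modulo the denominator, and the size condition excludes
divisibility by powers beyond p^L. -/
theorem shiftedVal_eq_sum_landau {p : ℕ} [Fact p.Prime] {x : ℚ} (hx : x ∈ Set.Ioc (0 : ℚ) 1)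
    {a : ℤ} (ha : (x.den : ℤ) ∣ a * p - 1) {n L : ℕ} (h : n * x.den < p ^ (L + 1)) :
    shiftedVal p x n = ∑ l ∈ Finset.Icc 1 L, landau (a ^ l * x) (n / p ^ l) := by
  rw [shiftedVal_eq_sum_card (ne_neg_natCast_of_mem_Ioc hx)
    fun k hk => (natAbs_num_add_mul_den_le hx hk).trans_lt h]
  refine Finset.sum_congr rfl fun l _ => ?_
  have hp := (Fact.out : p.Prime).pos
  have := card_filter_dvd_eq_landau hx (M := p ^ l) (by positivity) (a := a ^ l) (by
    have := sub_dvd_pow_sub_pow (a * p) 1 l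
    rw [one_pow, mul_pow] at this
    exact_mod_cast ha.trans this) n
  exact_mod_cast this

/-! ### Averaging Landau counts over multipliers -/

theorem sum_Icc_sub_succ (H : ℕ → ℤ) (L : ℕ) :
    ∑ l ∈ Finset.Icc 1 L, (H l - H (l + 1)) = H 1 - H (L + 1) := by
  induction L with
  | zero => simp
  | succ L ih => rw [Finset.sum_Icc_succ_top (by omega), ih]; ring

theorem landau_eq_zero {b T : ℚ} {D : ℕ} (hD : 0 < D) (k : ℤ) (hb : (D : ℚ) * b = k)
    (h0 : 0 ≤ T) (h1 : D * T < 1) : landau b T = 0 := by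
  rw [← landau_zero b]
  refine landau_congr_right hD k hb ?_
  rw [mul_zero, Int.floor_zero, Int.floor_eq_zero_iff]
  exact ⟨by positivity, h1⟩

/-- Summing over all i and removing the multiples of p gives two complete Hermite sums; their
difference telescopes in l. -/
theorem sum_landau_average_of_dvd {p : ℕ} [Fact p.Prime] {g D : ℕ} (hD : 0 < D)
    (hpD : ¬ p ∣ D) {a c : ℤ} (hc : a * p - 1 = D * c) (ha : ((p ^ (g + 1) : ℕ) : ℤ) ∣ a)
    {x : ℚ} (hxd : x.den ∣ p ^ (g + 1) * D) (hp : p ∣ x.den) {n L : ℕ}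
    (h : n * (p ^ (g + 1) * D) < p ^ (L + 1)) :
    ∑ l ∈ Finset.Icc 1 L, ∑ i ∈ (Finset.range (p ^ (g + 1))).filter (fun i => ¬ p ∣ i),
      landau (((a ^ l + D * i : ℤ) : ℚ) * x) (n / p ^ l) = p ^ g * n := by
  have hpp : p.Prime := Fact.out
  have hp0 : 0 < p := hpp.pos
  have hpq : (p : ℚ) ≠ 0 := by positivity
  obtain ⟨e', m, hpm, hxm⟩ := Nat.exists_eq_pow_mul_and_not_dvd x.den_nz p hpp.ne_one
  obtain ⟨e, rfl⟩ : ∃ e, e' = e + 1 := by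
    refine Nat.exists_eq_succ_of_ne_zero fun h0 => hpm ?_
    rwa [hxm, h0, pow_zero, one_mul] at hp
  have hm0 : 0 < m := Nat.pos_of_ne_zero fun h0 => hpm (h0 ▸ dvd_zero p)
  have hcopmp : ∀ j, Nat.Coprime m (p ^ j) := fun j =>
    ((Nat.Prime.coprime_iff_not_dvd hpp).2 hpm).symm.pow_right j
  have hcopDp : ∀ j, Nat.Coprime D (p ^ j) := fun j =>
    ((Nat.Prime.coprime_iff_not_dvd hpp).2 hpD).symm.pow_right j
  obtain ⟨D', hD'⟩ : m ∣ D :=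
    (hcopmp (g + 1)).dvd_of_dvd_mul_left ((Dvd.intro_left _ hxm.symm).trans hxd)
  have heg : e + 1 ≤ g + 1 := (Nat.pow_dvd_pow_iff_le_right hpp.one_lt).1
    ((hcopDp (e + 1)).symm.dvd_of_dvd_mul_right ((Dvd.intro _ hxm.symm).trans hxd))
  obtain ⟨k, rfl⟩ := Nat.exists_eq_add_of_le (Nat.le_of_succ_le_succ heg)
  have hxnum : x * (p ^ (e + 1) * m) = x.num := by
    have := Rat.mul_den_eq_num x
    rw [hxm] at this
    exact_mod_cast this
  -- Up to the denominator p^(e+1), u is Dx; it is prime to p, so the shifts D i x are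
  -- equidistributed modulo ℤ.
  set u : ℤ := D' * x.num with hu
  have hDx : (D : ℚ) * x = u / p ^ (e + 1) := by
    rw [hD', eq_div_iff (by positivity), hu]
    push_cast
    linear_combination (D' : ℚ) * hxnum
  have hcopu : ∀ j : ℕ, IsCoprime u ((p ^ j : ℕ) : ℤ) := fun j => by
    have h1 : ¬ p ∣ D' := fun h => hpD (hD' ▸ Dvd.dvd.mul_left h m)
    have hpi : Prime (p : ℤ) := Nat.prime_iff_prime_int.1 hpp
    have h2 : ¬ (p : ℤ) ∣ u := fun h => by
      rcases hpi.dvd_or_dvd h with h | h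
      · exact h1 (Int.natCast_dvd_natCast.1 h)
      · exact not_dvd_num_of_dvd_den hpp hp h
    push_cast
    exact ((Prime.coprime_iff_not_dvd hpi).2 h2).symm.pow_right
  set H : ℕ → ℤ := fun l => landau (p ^ (e + 1) * a ^ l * x) (p ^ (e + 1) * n / p ^ l) with hH
  have inner : ∀ l ∈ Finset.Icc 1 L,
      ∑ i ∈ (Finset.range (p ^ (e + k + 1))).filter (fun i => ¬ p ∣ i),
        landau (((a ^ l + D * i : ℤ) : ℚ) * x) (n / p ^ l) = p ^ k * (H l - H (l + 1)) := by
    intro l hl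
    -- `s1` is the sum over all i; `s2` is the sum over i = pj, where the shift becomes ju/p^e.
    have s1 := sum_landau_add_mul_div (a ^ l * x) (n / p ^ l) (m := p ^ (e + 1))
      (by positivity) (hcopu (e + 1)) (p ^ k)
    have s2 := sum_landau_add_mul_div (a ^ l * x) (n / p ^ l) (m := p ^ e)
      (by positivity) (hcopu e) (p ^ k)
    rw [← pow_add] at s1 s2
    have e1 : p ^ (e + k + 1) = p ^ (e + 1 + k) := by ring_nf
    rw [e1, show e + 1 + k = (e + k) + 1 by ring, pow_succ', sum_filter_not_dvd _ hp0,
      ← pow_succ', show (e + k) + 1 = e + 1 + k by ring, mul_sub]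
    congr 1
    · rw [hH]
      push_cast at s1
      refine Eq.trans (Finset.sum_congr rfl fun i _ => ?_) (s1.trans ?_)
      · congr 1
        push_cast
        rw [← hDx]
        ring
      · congr 2 <;> ring
    · refine Eq.trans (Finset.sum_congr rfl fun i _ => ?_) (s2.trans ?_)
      · congr 1
        push_cast
        have : (p : ℚ) * (D * x) = u / p ^ e := by
          rw [hDx]
          field_simp
          ring
        rw [← this]
        ring
      · push_cast
        simp only [hH]
        congr 1
        obtain ⟨b, hb⟩ := ha
        have hcq : (a : ℚ) * p - 1 = D * c := by exact_mod_cast hc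
        have hbq : (a : ℚ) = p ^ (e + k + 1) * b := by exact_mod_cast hb
        obtain ⟨l', rfl⟩ := Nat.exists_eq_add_of_le (Finset.mem_Icc.1 hl).1
        have hT : (p : ℚ) ^ (e + 1) * n / p ^ (1 + l' + 1) = p ^ e * (n / p ^ (1 + l')) := by
          field_simp
          ring
        rw [hT]
        -- The two arguments differ by a multiple of a(ap - 1)x, using l ≥ 1. The factor ap - 1 = Dc
        -- clears D, and a, divisible by p^(g+1), clears the power of p.
        refine landau_congr_left _ (-(c * a ^ l' * b * p ^ e * u * p ^ k)) ?_
        have h3 : (a : ℚ) * (D * x) = b * p ^ k * u := by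
          rw [hDx, hbq]
          field_simp
          ring
        push_cast
        calc (p : ℚ) ^ e * (a ^ (1 + l') * x) - p ^ (e + 1) * a ^ (1 + l' + 1) * x
            = -(p ^ e * a ^ l' * a * x * (a * p - 1)) := by ring
          _ = -(p ^ e * a ^ l' * c * (a * (D * x))) := by rw [hcq]; ring
          _ = _ := by rw [h3]; ring
  rw [Finset.sum_congr rfl inner, ← Finset.mul_sum, sum_Icc_sub_succ]
  -- At l = 1 the upper limit is the integer p^e n; at l = L + 1 it is below 1/D, so nothing is
  -- counted.
  have hH1 : H 1 = p ^ e * n := by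
    have : (p : ℚ) ^ (e + 1) * n / p ^ 1 = ((p ^ e * n : ℤ) : ℚ) := by
      push_cast
      field_simp
      ring
    rw [hH]
    simp only
    rw [this, landau_intCast]
  have hHL : H (L + 1) = 0 := by
    refine landau_eq_zero hD (a ^ (L + 1) * u) ?_ (by positivity) ?_
    · push_cast
      calc (D : ℚ) * (p ^ (e + 1) * a ^ (L + 1) * x) = a ^ (L + 1) * (p ^ (e + 1) * (D * x)) := by
            ring
        _ = _ := by
            rw [hDx]
            field_simp
    · rw [← mul_div_assoc, div_lt_one (by positivity)]
      have h1 : p ^ (e + 1) ≤ p ^ (e + k + 1) := Nat.pow_le_pow_right hp0 (by omega)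
      have h2 : D * (p ^ (e + 1) * n) ≤ n * (p ^ (e + k + 1) * D) := by
        calc D * (p ^ (e + 1) * n) = n * (p ^ (e + 1) * D) := by ring
          _ ≤ _ := by gcongr
      exact_mod_cast h2.trans_lt h
  rw [hH1, hHL]
  ring

theorem card_filter_not_dvd {p : ℕ} (hp : 0 < p) (m : ℕ) :
    (((Finset.range (p * m)).filter (fun i => ¬ p ∣ i)).card : ℤ) = m * (p - 1) := by
  have := sum_filter_not_dvd (fun _ => 1) hp m
  simp only [Finset.sum_const, Finset.card_range, nsmul_eq_mul, mul_one] at this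
  rw [this]
  push_cast
  ring

/-- If p does not divide the denominator of x, then Dx is an integer and all p^g(p-1) terms of the
inner sum coincide. -/
theorem sum_landau_average {p : ℕ} [Fact p.Prime] {g D : ℕ} (hD : 0 < D)
    (hpD : ¬ p ∣ D) {a c : ℤ} (hc : a * p - 1 = D * c) (ha : ((p ^ (g + 1) : ℕ) : ℤ) ∣ a)
    {x : ℚ} (hx : x ∈ Set.Ioc (0 : ℚ) 1) (hxd : x.den ∣ p ^ (g + 1) * D) {n L : ℕ}
    (h : n * (p ^ (g + 1) * D) < p ^ (L + 1)) :
    ∑ l ∈ Finset.Icc 1 L, ∑ i ∈ (Finset.range (p ^ (g + 1))).filter (fun i => ¬ p ∣ i),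
      landau (((a ^ l + D * i : ℤ) : ℚ) * x) (n / p ^ l)
        = p ^ g * ((p - 1) * shiftedVal p x n + if p ∣ x.den then (n : ℤ) else 0) := by
  have hpp : p.Prime := Fact.out
  split_ifs with hp
  · rw [sum_landau_average_of_dvd hD hpD hc ha hxd hp h, shiftedVal_eq_zero hpp hp]
    ring
  · have hcop : Nat.Coprime x.den (p ^ (g + 1)) :=
      ((Nat.Prime.coprime_iff_not_dvd hpp).2 hp).symm.pow_right _
    obtain ⟨D', hD'⟩ : x.den ∣ D := hcop.dvd_of_dvd_mul_left hxd
    have hle : x.den ≤ p ^ (g + 1) * D :=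
      Nat.le_of_dvd (Nat.mul_pos (pow_pos hpp.pos _) hD) hxd
    rw [shiftedVal_eq_sum_landau hx (a := a) (by
      rw [hc, hD']
      exact ⟨D' * c, by push_cast; ring⟩) ((Nat.mul_le_mul_left n hle).trans_lt h)]
    have hDx : (D : ℚ) * x = (D' * x.num : ℤ) := by
      have := Rat.mul_den_eq_num x
      rw [hD']
      push_cast
      linear_combination (D' : ℚ) * this
    have inner : ∀ l ∈ Finset.Icc 1 L,
        ∑ i ∈ (Finset.range (p ^ (g + 1))).filter (fun i => ¬ p ∣ i),
          landau (((a ^ l + D * i : ℤ) : ℚ) * x) (n / p ^ l)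
            = p ^ g * (p - 1) * landau (a ^ l * x) (n / p ^ l) := fun l _ => by
      have hterm : ∀ i : ℕ, landau (((a ^ l + D * i : ℤ) : ℚ) * x) (n / p ^ l)
          = landau (a ^ l * x) (n / p ^ l) := fun i =>
        landau_congr_left _ (i * (D' * x.num)) (by
          push_cast at hDx ⊢
          linear_combination (i : ℚ) * hDx)
      rw [Finset.sum_congr rfl fun i _ => hterm i, Finset.sum_const, nsmul_eq_mul, pow_succ',
        card_filter_not_dvd hpp.pos]
      push_cast
      ring
    rw [Finset.sum_congr rfl inner, ← Finset.mul_sum]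
    ring

/-! ### Growth of the valuations along n = p^m -/

/-- `(p - 1) v_p` of `∏_{k < p ^ m} (num x + k den x)` is `p ^ m` up to a bounded error when
`x ∈ ℤ_p`. -/
theorem exists_shiftedVal_pow_bound {p : ℕ} [Fact p.Prime] {x : ℚ} (hx : ∀ k : ℕ, x ≠ -(k : ℚ)) :
    ∃ K : ℤ, ∀ m : ℕ,
      |(p - 1) * shiftedVal p x (p ^ m) - if p ∣ x.den then 0 else (p : ℤ) ^ m| ≤ K := by
  have hpp : p.Prime := Fact.out
  by_cases hp : p ∣ x.den
  · exact ⟨0, fun m => by simp [hp, shiftedVal_eq_zero hpp hp]⟩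
  obtain ⟨K, hK⟩ : ∃ K, x.num.natAbs + x.den < p ^ K := ⟨_, Nat.lt_pow_self hpp.one_lt⟩
  have hp1 : (1 : ℤ) < p := by exact_mod_cast hpp.one_lt
  -- Levels l ≤ m contribute exactly (p^m - 1)/(p - 1); each of the K further levels contributes at
  -- most 1.
  refine ⟨(p - 1) * K + 1, fun m => ?_⟩
  rw [if_neg hp, shiftedVal_eq_sum_card hx (L := m + K) fun k hk => ?_]
  swap
  · have h1 : (x.num + k * x.den).natAbs ≤ x.num.natAbs + k * x.den := by
      refine (Int.natAbs_add_le _ _).trans ?_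
      rw [Int.natAbs_mul, Int.natAbs_natCast, Int.natAbs_natCast]
    calc (x.num + k * x.den).natAbs ≤ x.num.natAbs + k * x.den := h1
      _ ≤ p ^ m * x.num.natAbs + p ^ m * x.den := by
          gcongr
          exact Nat.le_mul_of_pos_left _ (pow_pos hpp.pos m)
      _ = p ^ m * (x.num.natAbs + x.den) := by ring
      _ < p ^ m * p ^ K := by
          have := pow_pos hpp.pos m
          gcongr
      _ ≤ p ^ (m + K + 1) := by
          rw [← pow_add]
          exact Nat.pow_le_pow_right hpp.pos (by omega)
  have hcop : ∀ l : ℕ, IsCoprime ((p ^ l : ℕ) : ℤ) x.den := fun l =>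
    Nat.isCoprime_iff_coprime.2 (((Nat.Prime.coprime_iff_not_dvd hpp).2 hp).pow_left l)
  have hcard : ∀ l : ℕ, ∃ v : ℤ, ∀ n : ℕ, (((Finset.range n).filter fun k : ℕ =>
      ((p ^ l : ℕ) : ℤ) ∣ x.num + k * x.den).card : ℤ)
        = (n - 1 - v) / ((p ^ l : ℕ) : ℤ) - (-1 - v) / ((p ^ l : ℕ) : ℤ) := fun l => by
    obtain ⟨s, t, hst⟩ := hcop l
    exact ⟨-t * x.num, card_filter_dvd_add_mul (pow_pos hpp.pos l) (hcop l)
      ⟨s * x.num, by linear_combination (-x.num) * hst⟩⟩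
  set c : ℕ → ℤ := fun l => (((Finset.range (p ^ m)).filter fun k : ℕ =>
      ((p ^ l : ℕ) : ℤ) ∣ x.num + k * x.den).card : ℤ) with hc
  have hlow : ∀ l ≤ m, c l = p ^ (m - l) := fun l hl => by
    obtain ⟨v, hv⟩ := hcard l
    have h1 : ((p ^ m : ℕ) : ℤ) - 1 - v = (-1 - v) + p ^ (m - l) * ((p ^ l : ℕ) : ℤ) := by
      push_cast
      rw [← pow_add, Nat.sub_add_cancel hl]
      ring
    rw [hc]
    simp only
    rw [hv, h1, Int.add_mul_ediv_right _ _ (by exact_mod_cast (pow_pos hpp.pos l).ne')]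
    ring
  have hhigh : ∀ l, m < l → c l ≤ 1 := fun l hl => by
    obtain ⟨v, hv⟩ := hcard l
    have hpos : (0 : ℤ) < ((p ^ l : ℕ) : ℤ) := by exact_mod_cast pow_pos hpp.pos l
    have h1 : ((p ^ m : ℕ) : ℤ) ≤ ((p ^ l : ℕ) : ℤ) := by
      exact_mod_cast Nat.pow_le_pow_right hpp.pos hl.le
    have h2 : (((p ^ m : ℕ) : ℤ) - 1 - v) / ((p ^ l : ℕ) : ℤ)
        ≤ ((-1 - v) + 1 * ((p ^ l : ℕ) : ℤ)) / ((p ^ l : ℕ) : ℤ) :=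
      Int.ediv_le_ediv hpos (by linarith)
    rw [Int.add_mul_ediv_right _ _ hpos.ne'] at h2
    rw [hc]
    simp only
    rw [hv]
    linarith
  have hgeom : ∀ M ≤ m, (p - 1) * ∑ l ∈ Finset.Icc 1 M, c l = (p : ℤ) ^ m - p ^ (m - M) := by
    intro M
    induction M with
    | zero => simp
    | succ M ih =>
      intro hM
      rw [Finset.sum_Icc_succ_top (by omega), mul_add, ih (by omega), hlow _ hM,
        show m - M = m - (M + 1) + 1 by omega, pow_succ]
      ring
  have htail : ∀ k : ℕ, 0 ≤ ∑ l ∈ Finset.Icc 1 (m + k), c l - ∑ l ∈ Finset.Icc 1 m, c l ∧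
      ∑ l ∈ Finset.Icc 1 (m + k), c l - ∑ l ∈ Finset.Icc 1 m, c l ≤ k := by
    intro k
    induction k with
    | zero => simp
    | succ k ih =>
      have h1 := hhigh (m + k + 1) (by omega)
      have h0 : 0 ≤ c (m + k + 1) := by positivity
      rw [← add_assoc, Finset.sum_Icc_succ_top (by omega)]
      push_cast
      constructor <;> linarith [ih.1, ih.2]
  have hg := hgeom m le_rfl
  obtain ⟨t0, t1⟩ := htail K
  rw [Nat.sub_self, pow_zero] at hg
  have u0 := mul_nonneg (sub_nonneg.2 hp1.le) t0
  have u1 := mul_le_mul_of_nonneg_left t1 (sub_nonneg.2 hp1.le)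
  rw [mul_sub] at u0 u1
  rw [abs_le]
  constructor <;> linarith

/-! ### Existence and uniqueness of the Eisenstein constant -/

theorem hasIntegerCoeffs_iff (f : PowerSeries ℚ) :
    HasIntegerCoeffs f ↔ ∀ n, ∃ z : ℤ, PowerSeries.coeff n f = z := by
  constructor
  · rintro ⟨g, rfl⟩ n
    exact ⟨PowerSeries.coeff n g, by simp⟩
  · intro h
    choose z hz using h
    exact ⟨PowerSeries.mk z, by ext n; simp [hz]⟩

theorem hasIntegerCoeffs_rescale_iff (f : PowerSeries ℚ) (x : ℚ) :
    HasIntegerCoeffs (PowerSeries.rescale x f) ↔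
      ∀ n, ∃ z : ℤ, x ^ n * PowerSeries.coeff n f = z := by
  simp only [hasIntegerCoeffs_iff, PowerSeries.coeff_rescale]

theorem HasIntegerCoeffs.rescale_mul_intCast {f : PowerSeries ℚ} {x : ℚ}
    (h : HasIntegerCoeffs (PowerSeries.rescale x f)) (k : ℤ) :
    HasIntegerCoeffs (PowerSeries.rescale (x * k) f) := by
  rw [hasIntegerCoeffs_rescale_iff] at h ⊢
  intro n
  obtain ⟨z, hz⟩ := h n
  exact ⟨k ^ n * z, by push_cast; rw [← hz]; ring⟩

/-- Write x = gu and y = gv with u, v coprime. A Bézout relation between u^n and v^n makes g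
admissible, hence also g(u + v). -/
theorem HasIntegerCoeffs.rescale_add {f : PowerSeries ℚ} {x y : ℚ}
    (hx : HasIntegerCoeffs (PowerSeries.rescale x f))
    (hy : HasIntegerCoeffs (PowerSeries.rescale y f)) :
    HasIntegerCoeffs (PowerSeries.rescale (x + y) f) := by
  have key : ∀ (g : ℚ) (u v : ℤ), IsCoprime u v → x = g * u → y = g * v →
      HasIntegerCoeffs (PowerSeries.rescale (x + y) f) := by
    intro g u v huv hxg hyg
    have hg : HasIntegerCoeffs (PowerSeries.rescale g f) := by
      rw [hasIntegerCoeffs_rescale_iff] at hx hy ⊢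
      intro n
      obtain ⟨a, ha⟩ := hx n
      obtain ⟨b, hb⟩ := hy n
      obtain ⟨s, t, hst⟩ := huv.pow (m := n) (n := n)
      refine ⟨s * a + t * b, ?_⟩
      have hst' : (s : ℚ) * u ^ n + t * v ^ n = 1 := by exact_mod_cast hst
      push_cast
      rw [← ha, ← hb, hxg, hyg]
      linear_combination (-(g ^ n * PowerSeries.coeff n f)) * hst'
    have := hg.rescale_mul_intCast (u + v)
    rwa [Int.cast_add, mul_add, ← hxg, ← hyg] at this
  set X : ℤ := x.num * y.den with hX
  set Y : ℤ := y.num * x.den with hY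
  have hxd : (x.den : ℚ) ≠ 0 := by exact_mod_cast x.den_nz
  have hyd : (y.den : ℚ) ≠ 0 := by exact_mod_cast y.den_nz
  have hxX : x = X / (x.den * y.den) := by
    rw [eq_div_iff (mul_ne_zero hxd hyd), hX]
    push_cast
    rw [← Rat.mul_den_eq_num x]
    ring
  have hyY : y = Y / (x.den * y.den) := by
    rw [eq_div_iff (mul_ne_zero hxd hyd), hY]
    push_cast
    rw [← Rat.mul_den_eq_num y]
    ring
  rcases Nat.eq_zero_or_pos (Int.gcd X Y) with h0 | h0
  · rw [Int.gcd_eq_zero_iff] at h0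
    have : y = 0 := by rw [hyY, h0.2]; simp
    rwa [this, add_zero]
  · obtain ⟨u, v, huv, hu, hv⟩ := Int.exists_gcd_one h0
    refine key ((Int.gcd X Y : ℤ) / (x.den * y.den)) u v (Int.isCoprime_iff_gcd_eq_one.2 huv) ?_ ?_
    · have hu' : (X : ℚ) = (Int.gcd X Y : ℤ) * u := by
        rw [mul_comm]
        exact_mod_cast hu
      rw [div_mul_eq_mul_div, ← hu']
      exact hxX
    · have hv' : (Y : ℚ) = (Int.gcd X Y : ℤ) * v := by
        rw [mul_comm]
        exact_mod_cast hv
      rw [div_mul_eq_mul_div, ← hv']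
      exact hyY

/-- The linear coefficient a forces every admissible x into a⁻¹ℤ, so the admissible set corresponds
to a subgroup of ℤ. -/
theorem exists_isEisensteinConstant {f : PowerSeries ℚ} (h1 : PowerSeries.coeff 1 f ≠ 0)
    (hf : IsNIntegral f) : ∃ c, IsEisensteinConstant f c := by
  obtain ⟨c₀, hc₀, hfc⟩ := hf
  set a := PowerSeries.coeff 1 f with ha
  let H : AddSubgroup ℤ :=
    { carrier := {k | HasIntegerCoeffs (PowerSeries.rescale ((k : ℚ) / a) f)}
      zero_mem' := by
        have := hfc.rescale_mul_intCast 0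
        simpa using this
      add_mem' := fun {k l} hk hl => by
        have := HasIntegerCoeffs.rescale_add hk hl
        rwa [← add_div, ← Int.cast_add] at this
      neg_mem' := fun {k} hk => by
        have := HasIntegerCoeffs.rescale_mul_intCast hk (-1)
        have e : (k : ℚ) / a * ((-1 : ℤ) : ℚ) = ((-k : ℤ) : ℚ) / a := by push_cast; ring
        rwa [e] at this }
  have mem_H : ∀ k : ℤ, k ∈ H ↔ HasIntegerCoeffs (PowerSeries.rescale ((k : ℚ) / a) f) :=
    fun k => Iff.rfl
  obtain ⟨g, hg⟩ := Int.subgroup_cyclic H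
  have mem_iff : ∀ k : ℤ, k ∈ H ↔ ∃ z : ℤ, k = g * z := fun k => by
    rw [hg, AddSubgroup.mem_closure_singleton]
    exact ⟨fun ⟨z, hz⟩ => ⟨z, by rw [← hz, smul_eq_mul, mul_comm]⟩,
      fun ⟨z, hz⟩ => ⟨z, by rw [hz, smul_eq_mul, mul_comm]⟩⟩
  have hset : ∀ x : ℚ, HasIntegerCoeffs (PowerSeries.rescale x f) ↔
      ∃ k : ℤ, x = g / a * k := fun x => by
    constructor
    · intro hx
      obtain ⟨z, hz⟩ := (hasIntegerCoeffs_rescale_iff f x).1 hx 1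
      rw [pow_one, ← ha] at hz
      have hxz : x = z / a := (eq_div_iff h1).2 hz
      rw [hxz, ← mem_H, mem_iff] at hx
      obtain ⟨k, hk⟩ := hx
      exact ⟨k, by rw [hxz, hk]; push_cast; ring⟩
    · rintro ⟨k, rfl⟩
      exact HasIntegerCoeffs.rescale_mul_intCast ((mem_H g).1 ((mem_iff g).2 ⟨1, by ring⟩)) k
  have hg0 : (g : ℚ) / a ≠ 0 := fun h => by
    obtain ⟨k, hk⟩ := (hset c₀).1 hfc
    rw [h, zero_mul] at hk
    exact hc₀ hk
  refine ⟨|(g : ℚ) / a|, abs_pos.2 hg0, ?_⟩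
  ext x
  simp only [Set.mem_ofPred_eq, hset]
  rcases abs_choice ((g : ℚ) / a) with h | h <;> rw [h]
  constructor <;> rintro ⟨k, rfl⟩ <;> exact ⟨-k, by push_cast; ring⟩

theorem IsEisensteinConstant.mem_iff {f : PowerSeries ℚ} {c : ℚ} (h : IsEisensteinConstant f c)
    (x : ℚ) : HasIntegerCoeffs (PowerSeries.rescale x f) ↔ ∃ k : ℤ, x = c * k :=
  Set.ext_iff.1 h.2 x

theorem Int.eq_one_of_pos_of_mul_eq_one {k l : ℤ} (hk : 0 < k) (h : k * l = 1) : k = 1 :=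
  Int.eq_one_of_mul_eq_one_right hk.le h

theorem IsEisensteinConstant.self_mem {f : PowerSeries ℚ} {c : ℚ} (h : IsEisensteinConstant f c) :
    HasIntegerCoeffs (PowerSeries.rescale c f) :=
  (h.mem_iff c).2 ⟨1, by simp⟩

theorem IsEisensteinConstant.unique {f : PowerSeries ℚ} {c c' : ℚ}
    (h : IsEisensteinConstant f c) (h' : IsEisensteinConstant f c') : c = c' := by
  obtain ⟨k, hk⟩ := (h.mem_iff c').1 h'.self_mem
  obtain ⟨l, hl⟩ := (h'.mem_iff c).1 h.self_mem
  have hkpos : (0 : ℚ) < k := pos_of_mul_pos_right (hk ▸ h'.1) h.1.le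
  have hkl : (k : ℚ) * l = 1 := by
    have : c * (k * l) = c * 1 := by rw [← mul_assoc, ← hk, ← hl, mul_one]
    exact mul_left_cancel₀ h.1.ne' this
  have := Int.eq_one_of_pos_of_mul_eq_one (by exact_mod_cast hkpos) (by exact_mod_cast hkl : k * l = 1)
  rw [hk, this, Int.cast_one, mul_one]

/-! ### Integrality prime by prime -/

theorem exists_intCast_eq_iff {q : ℚ} (hq : q ≠ 0) :
    (∃ z : ℤ, q = z) ↔ ∀ p : ℕ, p.Prime → 0 ≤ padicValRat p q := by
  constructor
  · rintro ⟨z, rfl⟩ p _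
    rw [padicValRat.of_int]
    positivity
  · intro h
    by_cases hd : q.den = 1
    · exact ⟨q.num, ((Rat.den_eq_one_iff q).1 hd).symm⟩
    · obtain ⟨p, hp, hpd⟩ := Nat.exists_prime_and_dvd hd
      have : Fact p.Prime := ⟨hp⟩
      have h1 := h p hp
      have h2 := one_le_padicValNat_of_dvd q.den_nz hpd
      rw [padicValRat_def, padicValInt.eq_zero_of_not_dvd (not_dvd_num_of_dvd_den hp hpd)] at h1
      omega

theorem padicValRat_prod {ι : Type*} {p : ℕ} [Fact p.Prime] (s : Finset ι) {f : ι → ℚ}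
    (hf : ∀ i ∈ s, f i ≠ 0) :
    padicValRat p (∏ i ∈ s, f i) = ∑ i ∈ s, padicValRat p (f i) := by
  classical
  induction s using Finset.induction_on with
  | empty => simp
  | insert i s his ih =>
    have h1 : ∀ j ∈ s, f j ≠ 0 := fun j hj => hf j (Finset.mem_insert_of_mem hj)
    rw [Finset.prod_insert his, Finset.sum_insert his,
      padicValRat.mul (hf i (Finset.mem_insert_self i s)) (Finset.prod_ne_zero_iff.2 h1), ih h1]

section

variable {r s : ℕ} (α : Fin r → ℚ) (β : Fin s → ℚ)

/-- The `p`-adic valuation of the quotient of the products of the denominators. -/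
def denVal (p : ℕ) : ℤ :=
  ∑ i, (padicValNat p (α i).den : ℤ) - ∑ j, (padicValNat p (β j).den : ℤ)

/-- The difference of the valuations `shiftedVal` over the numerator and denominator parameters. -/
def quotVal (p n : ℕ) : ℤ := ∑ i, shiftedVal p (α i) n - ∑ j, shiftedVal p (β j) n

theorem padicValRat_prod_den_div (p : ℕ) [Fact p.Prime] :
    padicValRat p ((∏ i, ((α i).den : ℚ)) / (∏ j, ((β j).den : ℚ))) = denVal α β p := by
  have h1 : ∀ x : ℚ, (x.den : ℚ) ≠ 0 := fun x => by exact_mod_cast x.den_nz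
  rw [padicValRat.div (Finset.prod_ne_zero_iff.2 fun i _ => h1 _)
    (Finset.prod_ne_zero_iff.2 fun i _ => h1 _), padicValRat_prod _ fun i _ => h1 _,
    padicValRat_prod _ fun i _ => h1 _, denVal]
  simp only [padicValRat.of_nat]

theorem den_dvd_commonDenominator_left (i : Fin r) : (α i).den ∣ commonDenominator α β :=
  (Finset.dvd_lcm (f := fun i => (α i).den) (Finset.mem_univ i)).trans (Nat.dvd_lcm_left _ _)

theorem den_dvd_commonDenominator_right (j : Fin s) : (β j).den ∣ commonDenominator α β :=
  (Finset.dvd_lcm (f := fun j => (β j).den) (Finset.mem_univ j)).trans (Nat.dvd_lcm_right _ _)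

theorem padicNorm_le_one_iff_not_dvd_den {p : ℕ} [Fact p.Prime] (x : ℚ) :
    padicNorm p x ≤ 1 ↔ ¬ p ∣ x.den := by
  have hd0 : padicNorm p (x.den : ℚ) ≠ 0 := padicNorm.nonzero (by exact_mod_cast x.den_nz)
  have hpos := lt_of_le_of_ne (padicNorm.nonneg (p := p) (x.den : ℚ)) hd0.symm
  have hx : padicNorm p x = padicNorm p x.num / padicNorm p x.den := by
    rw [← padicNorm.div, Rat.num_div_den]
  rw [hx]
  constructor
  · intro h hd
    have h1 := (padicNorm.int_eq_one_iff x.num).2 (not_dvd_num_of_dvd_den Fact.out hd)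
    have h2 := (padicNorm.nat_lt_one_iff x.den).2 hd
    rw [h1, div_le_one hpos] at h
    exact h.not_gt h2
  · intro hd
    rw [(padicNorm.nat_eq_one_iff x.den).2 hd, div_one]
    exact padicNorm.of_int _

theorem lambdaP_eq_sum (p : ℕ) [Fact p.Prime] :
    lambdaP p α β = ∑ i, (if p ∣ (α i).den then 0 else 1) - ∑ j, (if p ∣ (β j).den then 0 else 1) := by
  simp only [lambdaP, Finset.card_filter, padicNorm_le_one_iff_not_dvd_den, ite_not]
  push_cast
  rfl

theorem lambdaP_of_not_dvd {p : ℕ} [Fact p.Prime] (h : ¬ p ∣ commonDenominator α β) :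
    lambdaP p α β = r - s := by
  rw [lambdaP_eq_sum, Finset.sum_congr rfl fun i _ => if_neg fun hi =>
      h (hi.trans (den_dvd_commonDenominator_left α β i)), Finset.sum_congr rfl fun j _ =>
      if_neg fun hj => h (hj.trans (den_dvd_commonDenominator_right α β j))]
  simp

theorem padicValRat_prod_exceptionalPrimes (p : ℕ) [Fact p.Prime] (k : ℕ → ℤ) :
    padicValRat p (∏ q ∈ exceptionalPrimes α β, (q : ℚ) ^ k q)
      = if p ∈ exceptionalPrimes α β then k p else 0 := by
  have hprime : ∀ q ∈ exceptionalPrimes α β, q.Prime := fun q hq =>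
    ((mem_exceptionalPrimes α β q).1 hq).1
  rw [padicValRat_prod _ fun q hq => zpow_ne_zero _ (by exact_mod_cast (hprime q hq).ne_zero)]
  have h1 : ∀ q ∈ exceptionalPrimes α β, padicValRat p ((q : ℚ) ^ k q)
      = if p = q then k q else 0 := fun q hq => by
    have : Fact q.Prime := ⟨hprime q hq⟩
    rw [padicValRat.zpow, padicValRat.of_nat]
    split_ifs with hpq
    · subst hpq
      rw [padicValNat_self, Nat.cast_one, mul_one]
    · rw [padicValNat_primes hpq, Nat.cast_zero, mul_zero]
  rw [Finset.sum_congr rfl h1, Finset.sum_ite_eq]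

variable {α β}

theorem hypergeometricSeries_coeff_ne_zero (hα : ∀ (i : Fin r) (k : ℕ), α i ≠ -(k : ℚ))
    (hβ : ∀ (j : Fin s) (k : ℕ), β j ≠ -(k : ℚ)) (n : ℕ) :
    PowerSeries.coeff n (hypergeometricSeries α β) ≠ 0 := by
  rw [hypergeometricSeries, PowerSeries.coeff_mk]
  exact div_ne_zero (Finset.prod_ne_zero_iff.2 fun i _ => ascPochhammer_eval_ne_zero (hα i) n)
    (Finset.prod_ne_zero_iff.2 fun j _ => ascPochhammer_eval_ne_zero (hβ j) n)

theorem padicValRat_coeff_hypergeometricSeries (hα : ∀ (i : Fin r) (k : ℕ), α i ≠ -(k : ℚ))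
    (hβ : ∀ (j : Fin s) (k : ℕ), β j ≠ -(k : ℚ)) (p : ℕ) [Fact p.Prime] (n : ℕ) :
    padicValRat p (PowerSeries.coeff n (hypergeometricSeries α β))
      = quotVal α β p n - n * denVal α β p := by
  rw [hypergeometricSeries, PowerSeries.coeff_mk, padicValRat.div
    (Finset.prod_ne_zero_iff.2 fun i _ => ascPochhammer_eval_ne_zero (hα i) n)
    (Finset.prod_ne_zero_iff.2 fun j _ => ascPochhammer_eval_ne_zero (hβ j) n),
    padicValRat_prod _ fun i _ => ascPochhammer_eval_ne_zero (hα i) n,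
    padicValRat_prod _ fun j _ => ascPochhammer_eval_ne_zero (hβ j) n, quotVal, denVal]
  simp only [padicValRat_ascPochhammer (hα _), padicValRat_ascPochhammer (hβ _),
    Finset.sum_sub_distrib, ← Finset.mul_sum]
  ring

theorem hasIntegerCoeffs_rescale_hypergeometricSeries_iff
    (hα : ∀ (i : Fin r) (k : ℕ), α i ≠ -(k : ℚ)) (hβ : ∀ (j : Fin s) (k : ℕ), β j ≠ -(k : ℚ))
    {x : ℚ} (hx : x ≠ 0) :
    HasIntegerCoeffs (PowerSeries.rescale x (hypergeometricSeries α β)) ↔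
      ∀ p : ℕ, p.Prime → ∀ n : ℕ,
        0 ≤ quotVal α β p n + n * (padicValRat p x - denVal α β p) := by
  rw [hasIntegerCoeffs_rescale_iff]
  have h : ∀ n, (∃ z : ℤ, x ^ n * PowerSeries.coeff n (hypergeometricSeries α β) = z) ↔
      ∀ p : ℕ, p.Prime → 0 ≤ quotVal α β p n + n * (padicValRat p x - denVal α β p) := fun n => by
    have hc := hypergeometricSeries_coeff_ne_zero hα hβ n
    rw [exists_intCast_eq_iff (mul_ne_zero (pow_ne_zero n hx) hc)]
    refine forall₂_congr fun p hp => ?_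
    have : Fact p.Prime := ⟨hp⟩
    rw [padicValRat.mul (pow_ne_zero n hx) hc, padicValRat.pow,
      padicValRat_coeff_hypergeometricSeries hα hβ]
    ring_nf
  simp only [h]
  exact ⟨fun H p hp n => H n p hp, fun H n p hp => H p hp n⟩

theorem quotVal_pow_bound (hα : ∀ (i : Fin r) (k : ℕ), α i ≠ -(k : ℚ))
    (hβ : ∀ (j : Fin s) (k : ℕ), β j ≠ -(k : ℚ)) (p : ℕ) [Fact p.Prime] :
    ∃ K : ℤ, ∀ m : ℕ, (p - 1) * quotVal α β p (p ^ m) ≤ lambdaP p α β * p ^ m + K := by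
  choose K hK using fun i => exists_shiftedVal_pow_bound (p := p) (hα i)
  choose K' hK' using fun j => exists_shiftedVal_pow_bound (p := p) (hβ j)
  refine ⟨∑ i, K i + ∑ j, K' j, fun m => ?_⟩
  have h1 := Finset.sum_le_sum fun i (_ : i ∈ Finset.univ) => (abs_le.1 (hK i m)).2
  have h2 := Finset.sum_le_sum fun j (_ : j ∈ Finset.univ) => (abs_le.1 (hK' j m)).1
  rw [Finset.sum_sub_distrib, ← Finset.mul_sum] at h1 h2
  rw [Finset.sum_neg_distrib] at h2
  have h3 : ∀ q : Prop, ∀ [Decidable q], (if q then 0 else (p : ℤ) ^ m)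
      = (if q then 0 else 1) * (p : ℤ) ^ m := fun q _ => by split_ifs <;> simp
  simp only [h3, ← Finset.sum_mul] at h1 h2
  rw [lambdaP_eq_sum, quotVal, mul_sub, sub_mul]
  linarith

/-- Otherwise λ_p + (p-1)t ≤ -1, and at n = p^m > K the linear term outweighs the bounded error. -/
theorem neg_lambdaP_le (hα : ∀ (i : Fin r) (k : ℕ), α i ≠ -(k : ℚ))
    (hβ : ∀ (j : Fin s) (k : ℕ), β j ≠ -(k : ℚ)) (p : ℕ) [Fact p.Prime] {t : ℤ}
    (h : ∀ n : ℕ, 0 ≤ quotVal α β p n + n * t) : -lambdaP p α β ≤ (p - 1) * t := by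
  have hp1 : (1 : ℤ) < p := by exact_mod_cast (Fact.out : p.Prime).one_lt
  obtain ⟨K, hK⟩ := quotVal_pow_bound hα hβ p
  by_contra! hlt
  obtain ⟨m, hm⟩ : ∃ m : ℕ, K < (p : ℤ) ^ m := by
    refine ⟨K.toNat, (Int.self_le_toNat K).trans_lt ?_⟩
    exact_mod_cast Nat.lt_pow_self (Fact.out : p.Prime).one_lt
  have h1 := mul_nonneg (sub_nonneg.2 hp1.le) (h (p ^ m))
  have h2 := hK m
  have h3 : (0 : ℤ) < (p : ℤ) ^ m := by positivity
  push_cast at h1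
  have h4 : (lambdaP p α β + (p - 1) * t) * (p : ℤ) ^ m ≤ -1 * (p : ℤ) ^ m :=
    mul_le_mul_of_nonneg_right (by linarith) h3.le
  linarith

end

/-! ### Christol's inequalities and their average -/

section

variable {r : ℕ} {α β : Fin r → ℚ}

/-- Christol's criterion: the Landau functions of an `N`-integral series are nonnegative. -/
theorem sum_landau_le_sum_landau (hα : ∀ i, α i ∈ Set.Ioc (0 : ℚ) 1)
    (hβ : ∀ j, β j ∈ Set.Ioc (0 : ℚ) 1) (hF : IsNIntegral (hypergeometricSeries α β))
    {d : ℕ} (hd : 0 < d) (hαd : ∀ i, (α i).den ∣ d) (hβd : ∀ j, (β j).den ∣ d)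
    {a : ℤ} (ha : IsCoprime a d) (T : ℚ) :
    ∑ j, landau (a * β j) T ≤ ∑ i, landau (a * α i) T := by
  obtain ⟨c, hc0, hc⟩ := hF
  rw [hasIntegerCoeffs_rescale_hypergeometricSeries_iff
    (fun i => ne_neg_natCast_of_mem_Ioc (hα i)) (fun j => ne_neg_natCast_of_mem_Ioc (hβ j)) hc0]
    at hc
  obtain ⟨u, v, huv⟩ := ha
  -- By Dirichlet there is a prime q inverse to a modulo d, large enough that c and all the
  -- denominators are q-adic units.
  obtain ⟨q, hq, hqp, hqmod⟩ := Nat.forall_exists_prime_gt_and_zmodEq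
    (d + c.num.natAbs + c.den) (a := u) hd.ne' ⟨a, v, by linear_combination huv⟩
  have : Fact q.Prime := ⟨hqp⟩
  have hq0 : (0 : ℚ) < q := by exact_mod_cast hqp.pos
  have hd0 : (0 : ℚ) < d := by exact_mod_cast hd
  have hqd : (d : ℚ) < q := by exact_mod_cast (by omega : d < q)
  have haq : (d : ℤ) ∣ a * q - 1 := by
    obtain ⟨w, hw⟩ := Int.modEq_iff_dvd.1 hqmod
    exact ⟨-v - a * w, by linear_combination huv - a * hw⟩
  have hval : ∀ m : ℕ, 0 < m → m < q → padicValNat q m = 0 := fun m h0 h1 =>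
    padicValNat.eq_zero_of_not_dvd (Nat.not_dvd_of_pos_of_lt h0 h1)
  have hle : ∀ {m : ℕ}, m ∣ d → m ≤ d := fun h => Nat.le_of_dvd hd h
  have hden : denVal α β q = 0 := by
    rw [denVal, Finset.sum_eq_zero fun i _ => ?_, Finset.sum_eq_zero fun j _ => ?_, sub_zero]
    · rw [hval _ (β j).den_pos (by have := hle (hβd j); omega), Nat.cast_zero]
    · rw [hval _ (α i).den_pos (by have := hle (hαd i); omega), Nat.cast_zero]
  have hcv : padicValRat q c = 0 := by
    rw [padicValRat_def, padicValInt,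
      hval _ (Int.natAbs_pos.2 (Rat.num_ne_zero.2 hc0)) (by omega), hval _ c.den_pos (by omega)]
    simp
  set k : ℕ := ⌊(d : ℚ) * Int.fract T⌋₊ with hk
  have hT0 : 0 ≤ (d : ℚ) * Int.fract T := mul_nonneg hd0.le (Int.fract_nonneg T)
  have hkT : (k : ℚ) ≤ d * Int.fract T := Nat.floor_le hT0
  have hkd : (k : ℚ) ≤ d := hkT.trans (mul_le_of_le_one_right hd0.le (Int.fract_lt_one T).le)
  -- As d < q, this n satisfies k ≤ dn/q < k + 1, so n/q and the fractional part of T give the same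
  -- Landau counts.
  set n : ℕ := ⌈(q : ℚ) * k / d⌉₊ with hn
  have hn1 : (q : ℚ) * k / d ≤ n := Nat.le_ceil _
  have hn2 : (n : ℚ) < q * k / d + 1 := Nat.ceil_lt_add_one (by positivity)
  have hnq : n ≤ q := Nat.ceil_le.2 (by
    rw [div_le_iff₀ hd0]
    exact mul_le_mul_of_nonneg_left hkd hq0.le)
  have hfloor : ⌊(d : ℚ) * Int.fract T⌋ = ⌊(d : ℚ) * (n / q)⌋ := by
    rw [← Int.natCast_floor_eq_floor hT0, ← hk]
    symm
    rw [Int.floor_eq_iff, Int.cast_natCast, ← mul_div_assoc, le_div_iff₀ hq0, div_lt_iff₀ hq0]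
    rw [div_le_iff₀ hd0] at hn1
    rw [div_add_one hd0.ne', lt_div_iff₀ hd0] at hn2
    constructor <;> linarith
  have hlandau : ∀ x ∈ Set.Ioc (0 : ℚ) 1, x.den ∣ d →
      landau (a * x) T = shiftedVal q x n + ⌊T⌋ := by
    rintro x hx ⟨m, hm⟩
    -- Below q², only the level l = 1 survives in Legendre's formula.
    have h1 : n * x.den < q ^ (1 + 1) := by
      have h2 : x.den < q := by have := hle ⟨m, hm⟩; omega
      calc n * x.den ≤ q * x.den := Nat.mul_le_mul_right _ hnq
        _ < q * q := Nat.mul_lt_mul_of_pos_left h2 hqp.pos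
        _ = _ := by ring
    rw [shiftedVal_eq_sum_landau hx (a := a)
      ((Int.natCast_dvd_natCast.2 ⟨m, hm⟩).trans haq) h1, Finset.Icc_self, Finset.sum_singleton,
      pow_one, pow_one, ← Int.fract_add_floor T, landau_add_intCast_right, Int.fract_add_floor]
    congr 1
    refine landau_congr_right hd (m * a * x.num) ?_ hfloor
    rw [hm]
    push_cast
    linear_combination (m * a : ℚ) * Rat.mul_den_eq_num x
  have h := hc q hqp n
  rw [hcv, hden, sub_self, mul_zero, add_zero, quotVal] at h
  rw [Finset.sum_congr rfl fun i _ => hlandau _ (hα i) (hαd i),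
    Finset.sum_congr rfl fun j _ => hlandau _ (hβ j) (hβd j), Finset.sum_add_distrib,
    Finset.sum_add_distrib]
  linarith

/-- Christol's inequalities are summed over all levels and multipliers. As both tuples have length
r, the surplus of non-p-integral parameters is -λ_p. -/
theorem lambdaP_mul_le_quotVal (hα : ∀ i, α i ∈ Set.Ioc (0 : ℚ) 1)
    (hβ : ∀ j, β j ∈ Set.Ioc (0 : ℚ) 1) (hF : IsNIntegral (hypergeometricSeries α β))
    (p : ℕ) [Fact p.Prime] (n : ℕ) : lambdaP p α β * n ≤ (p - 1) * quotVal α β p n := by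
  have hpp : p.Prime := Fact.out
  have hpi : Prime (p : ℤ) := Nat.prime_iff_prime_int.1 hpp
  obtain ⟨g, D, hpD, hgD⟩ := Nat.exists_eq_pow_mul_and_not_dvd
    (commonDenominator_pos α β).ne' p hpp.ne_one
  have hD : 0 < D := Nat.pos_of_ne_zero fun h => hpD (h ▸ dvd_zero p)
  -- The extra factor p keeps the exponent positive even when p divides no denominator.
  set d := p ^ (g + 1) * D with hd
  have hd0 : 0 < d := Nat.mul_pos (pow_pos hpp.pos _) hD
  have hdvd : commonDenominator α β ∣ d := ⟨p, by rw [hd, hgD]; ring⟩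
  have hαd := fun i => (den_dvd_commonDenominator_left α β i).trans hdvd
  have hβd := fun j => (den_dvd_commonDenominator_right α β j).trans hdvd
  have hpD' : IsCoprime (p : ℤ) D :=
    Nat.isCoprime_iff_coprime.2 ((Nat.Prime.coprime_iff_not_dvd hpp).2 hpD)
  obtain ⟨u, v, huv⟩ := hpD'.pow_left (m := g + 2)
  -- Thus a is 0 modulo p^(g+1) and inverse to p modulo D; a^l + Di is then prime to d exactly when
  -- p does not divide i.
  set a : ℤ := u * p ^ (g + 1) with ha
  have hap : a * p - 1 = D * (-v) := by linear_combination huv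
  have hpa : ((p ^ (g + 1) : ℕ) : ℤ) ∣ a := ⟨u, by push_cast; ring⟩
  have hpa1 : (p : ℤ) ∣ a := ⟨u * p ^ g, by rw [ha]; ring⟩
  have haD : IsCoprime a D := ⟨p, v, by linear_combination hap⟩
  have hcop : ∀ l ∈ Finset.Icc 1 (n * d), ∀ i ∈ (Finset.range (p ^ (g + 1))).filter
      (fun i => ¬ p ∣ i), IsCoprime (a ^ l + D * i) d := fun l hl i hi => by
    have h1 : ¬ (p : ℤ) ∣ a ^ l + D * i := fun h => by
      have hl0 : l ≠ 0 := by have := (Finset.mem_Icc.1 hl).1; omega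
      rcases hpi.dvd_or_dvd ((dvd_add_right (dvd_pow hpa1 hl0)).1 h) with h | h
      · exact hpD (Int.natCast_dvd_natCast.1 h)
      · exact (Finset.mem_filter.1 hi).2 (Int.natCast_dvd_natCast.1 h)
    rw [hd]
    push_cast
    refine IsCoprime.mul_right ((Prime.coprime_iff_not_dvd hpi).2 h1).symm.pow_right ?_
    rw [mul_comm (D : ℤ)]
    exact (haD.pow_left (m := l)).add_mul_right_left i
  have hL : n * (p ^ (g + 1) * D) < p ^ (n * d + 1) :=
    (Nat.lt_pow_self hpp.one_lt).trans (Nat.pow_lt_pow_right hpp.one_lt (Nat.lt_succ_self _))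
  have hsum := Finset.sum_le_sum fun l hl => Finset.sum_le_sum fun i hi =>
    sum_landau_le_sum_landau hα hβ hF hd0 hαd hβd (hcop l hl i hi) (n / p ^ l)
  have hswap : ∀ γ : Fin r → ℚ, (∀ i, γ i ∈ Set.Ioc (0 : ℚ) 1) → (∀ i, (γ i).den ∣ d) →
      ∑ l ∈ Finset.Icc 1 (n * d), ∑ i ∈ (Finset.range (p ^ (g + 1))).filter (fun i => ¬ p ∣ i),
        ∑ j, landau (((a ^ l + D * i : ℤ) : ℚ) * γ j) (n / p ^ l)
      = p ^ g * ((p - 1) * ∑ j, shiftedVal p (γ j) n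
          + (r - ∑ j, if p ∣ (γ j).den then 0 else 1) * n) := fun γ hγ hγd => by
    have h1 : ∀ l ∈ Finset.Icc 1 (n * d),
        ∑ i ∈ (Finset.range (p ^ (g + 1))).filter (fun i => ¬ p ∣ i),
          ∑ j, landau (((a ^ l + D * i : ℤ) : ℚ) * γ j) (n / p ^ l)
        = ∑ j, ∑ i ∈ (Finset.range (p ^ (g + 1))).filter (fun i => ¬ p ∣ i),
          landau (((a ^ l + D * i : ℤ) : ℚ) * γ j) (n / p ^ l) := fun l _ => Finset.sum_comm
    rw [Finset.sum_congr rfl h1, Finset.sum_comm, Finset.sum_congr rfl fun j _ =>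
      sum_landau_average hD hpD hap hpa (hγ j) (hγd j) hL, ← Finset.mul_sum,
      Finset.sum_add_distrib, ← Finset.mul_sum]
    have h2 : ∀ j, (if p ∣ (γ j).den then (n : ℤ) else 0)
        = (1 - if p ∣ (γ j).den then 0 else 1) * n := fun j => by split_ifs <;> simp
    rw [Finset.sum_congr rfl fun j _ => h2 j, ← Finset.sum_mul, Finset.sum_sub_distrib]
    simp
  rw [hswap α hα hαd, hswap β hβ hβd] at hsum
  have hpg : (0 : ℤ) < p ^ g := by exact_mod_cast pow_pos hpp.pos g
  have := le_of_mul_le_mul_left hsum hpg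
  rw [lambdaP_eq_sum, quotVal, mul_sub, sub_mul]
  linarith

end

/-! ### Comparison with the predicted constant -/

section

variable {r s : ℕ} (α : Fin r → ℚ) (β : Fin s → ℚ)

/-- The Eisenstein constant predicted for parameters in `(0, 1]`. -/
def eisensteinDivisor : ℚ :=
  ((∏ i, ((α i).den : ℚ)) / (∏ j, ((β j).den : ℚ))) *
    ∏ p ∈ exceptionalPrimes α β, (p : ℚ) ^ (-⌊(lambdaP p α β : ℚ) / ((p : ℚ) - 1)⌋)

theorem eisensteinDivisor_factors_pos :
    0 < (∏ i, ((α i).den : ℚ)) / (∏ j, ((β j).den : ℚ)) ∧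
    0 < ∏ p ∈ exceptionalPrimes α β,
      (p : ℚ) ^ (-⌊(lambdaP p α β : ℚ) / ((p : ℚ) - 1)⌋) := by
  have h1 : ∀ x : ℚ, (0 : ℚ) < x.den := fun x => by exact_mod_cast x.den_pos
  refine ⟨div_pos (Finset.prod_pos fun i _ => h1 _) (Finset.prod_pos fun j _ => h1 _),
    Finset.prod_pos fun p hp => zpow_pos ?_ _⟩
  exact_mod_cast ((mem_exceptionalPrimes α β p).1 hp).1.pos

theorem eisensteinDivisor_pos : 0 < eisensteinDivisor α β :=
  mul_pos (eisensteinDivisor_factors_pos α β).1 (eisensteinDivisor_factors_pos α β).2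

theorem padicValRat_eisensteinDivisor (p : ℕ) [Fact p.Prime] :
    padicValRat p (eisensteinDivisor α β) = denVal α β p +
      if p ∈ exceptionalPrimes α β then -⌊(lambdaP p α β : ℚ) / ((p : ℚ) - 1)⌋ else 0 := by
  rw [eisensteinDivisor, padicValRat.mul (eisensteinDivisor_factors_pos α β).1.ne'
    (eisensteinDivisor_factors_pos α β).2.ne', padicValRat_prod_den_div,
    padicValRat_prod_exceptionalPrimes α β p
      fun p => -⌊(lambdaP p α β : ℚ) / ((p : ℚ) - 1)⌋]

variable {α β}

theorem padicValRat_eisensteinDivisor_le (hα : ∀ (i : Fin r) (k : ℕ), α i ≠ -(k : ℚ))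
    (hβ : ∀ (j : Fin s) (k : ℕ), β j ≠ -(k : ℚ)) {c : ℚ} (hc0 : c ≠ 0)
    (hc : HasIntegerCoeffs (PowerSeries.rescale c (hypergeometricSeries α β)))
    (p : ℕ) [Fact p.Prime] :
    padicValRat p (eisensteinDivisor α β) ≤ padicValRat p c := by
  have hpp : p.Prime := Fact.out
  have hp1 : (1 : ℤ) < p := by exact_mod_cast hpp.one_lt
  have h := neg_lambdaP_le hα hβ p
    ((hasIntegerCoeffs_rescale_hypergeometricSeries_iff hα hβ hc0).1 hc p hpp)
  rw [padicValRat_eisensteinDivisor, ← le_sub_iff_add_le']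
  set t := padicValRat p c - denVal α β p
  split_ifs with hp
  · rw [neg_le, Int.le_floor, le_div_iff₀ (sub_pos.2 (by exact_mod_cast hpp.one_lt))]
    have : -t * ((p : ℤ) - 1) ≤ lambdaP p α β := by linarith
    exact_mod_cast this
  · rw [mem_exceptionalPrimes] at hp
    push Not at hp
    obtain ⟨h1, h2⟩ := hp hpp
    rw [lambdaP_of_not_dvd α β h1] at h
    -- Here r - s ≤ p - 2, so t ≤ -1 would violate r - s + (p-1)t ≥ 0.
    by_contra! ht
    have : (p - 1) * t ≤ (p - 1) * (-1 : ℤ) :=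
      mul_le_mul_of_nonneg_left (by omega) (by linarith)
    linarith

end

theorem hasIntegerCoeffs_rescale_eisensteinDivisor {r : ℕ} {α β : Fin r → ℚ}
    (hα : ∀ i, α i ∈ Set.Ioc (0 : ℚ) 1) (hβ : ∀ j, β j ∈ Set.Ioc (0 : ℚ) 1)
    (hF : IsNIntegral (hypergeometricSeries α β)) :
    HasIntegerCoeffs (PowerSeries.rescale (eisensteinDivisor α β) (hypergeometricSeries α β)) := by
  rw [hasIntegerCoeffs_rescale_hypergeometricSeries_iff
    (fun i => ne_neg_natCast_of_mem_Ioc (hα i)) (fun j => ne_neg_natCast_of_mem_Ioc (hβ j))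
    (eisensteinDivisor_pos α β).ne']
  intro p hpp n
  have : Fact p.Prime := ⟨hpp⟩
  have hp1 : (0 : ℤ) < p - 1 := sub_pos.2 (by exact_mod_cast hpp.one_lt)
  have h := lambdaP_mul_le_quotVal hα hβ hF p n
  rw [padicValRat_eisensteinDivisor, add_sub_cancel_left]
  refine nonneg_of_mul_nonneg_right ?_ hp1
  have hle : 0 ≤ (p - 1) * (if p ∈ exceptionalPrimes α β then
      -⌊(lambdaP p α β : ℚ) / ((p : ℚ) - 1)⌋ else 0) + lambdaP p α β := by
    split_ifs with hp
    · have h1 := Int.floor_le ((lambdaP p α β : ℚ) / ((p : ℚ) - 1))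
      rw [le_div_iff₀ (by exact_mod_cast hp1)] at h1
      have h2 : ⌊(lambdaP p α β : ℚ) / ((p : ℚ) - 1)⌋ * ((p : ℤ) - 1) ≤ lambdaP p α β := by
        exact_mod_cast h1
      linarith
    · have h1 : ¬ p ∣ commonDenominator α β := fun h1 =>
        hp ((mem_exceptionalPrimes α β p).2 ⟨hpp, Or.inl h1⟩)
      simp [lambdaP_of_not_dvd α β h1]
  have := mul_nonneg hle (Int.natCast_nonneg n)
  rw [add_mul] at this
  linarith

theorem mainTheorem4 (r s : ℕ) (α : Fin r → ℚ) (β : Fin s → ℚ)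
    (hα : ∀ (i : Fin r) (k : ℕ), α i ≠ -(k : ℚ))
    (hβ : ∀ (j : Fin s) (k : ℕ), β j ≠ -(k : ℚ))
    (hF : IsNIntegral (hypergeometricSeries α β)) :
    (∃! c : ℚ, IsEisensteinConstant (hypergeometricSeries α β) c) ∧
      ∀ c : ℚ, IsEisensteinConstant (hypergeometricSeries α β) c →
        ∃ C : ℕ, 0 < C ∧
          c = (C : ℚ) * ((∏ i, ((α i).den : ℚ)) / (∏ j, ((β j).den : ℚ))) *
            ∏ p ∈ exceptionalPrimes α β,
              (p : ℚ) ^ (-⌊(lambdaP p α β : ℚ) / ((p : ℚ) - 1)⌋) ∧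
          (r = s → (∀ i, α i ∈ Set.Ioc (0 : ℚ) 1) → (∀ j, β j ∈ Set.Ioc (0 : ℚ) 1) → C = 1) := by
  constructor
  · obtain ⟨c, hc⟩ := exists_isEisensteinConstant
      (hypergeometricSeries_coeff_ne_zero hα hβ 1) hF
    exact ⟨c, hc, fun c' hc' => hc'.unique hc⟩
  · intro c hc
    have hE := eisensteinDivisor_pos α β
    obtain ⟨k, hk⟩ := (exists_intCast_eq_iff (div_pos hc.1 hE).ne').2 fun p hp => by
      have : Fact p.Prime := ⟨hp⟩
      rw [padicValRat.div hc.1.ne' hE.ne', sub_nonneg]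
      exact padicValRat_eisensteinDivisor_le hα hβ hc.1.ne' hc.self_mem p
    have hk0 : 0 < k := by
      have := div_pos hc.1 hE
      rw [hk] at this
      exact_mod_cast this
    lift k to ℕ using hk0.le
    have hck : c = k * eisensteinDivisor α β := by
      rw [div_eq_iff hE.ne'] at hk
      exact_mod_cast hk
    refine ⟨k, by exact_mod_cast hk0, by rw [mul_assoc]; exact hck, ?_⟩
    rintro rfl hα' hβ'
    -- The predicted constant lies in cℤ while c is k times it, so k is a unit.
    obtain ⟨l, hl⟩ := (hc.mem_iff _).1 (hasIntegerCoeffs_rescale_eisensteinDivisor hα' hβ' hF)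
    have hkl : (k : ℤ) * l = 1 := by
      have h1 : eisensteinDivisor α β * (k * l) = eisensteinDivisor α β * 1 := by
        rw [mul_one]
        nth_rewrite 2 [hl]
        rw [hck]
        ring
      exact_mod_cast mul_left_cancel₀ hE.ne' h1
    exact_mod_cast Int.eq_one_of_pos_of_mul_eq_one hk0 hkl
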